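/- Let $G$ be a hyperbolic group. That is, $G$ is a group with a finite generating set $S$ for which there is a constant $\delta\ge 0$ such that all geodesic triangles in the Cayley graph of $G$ with respect to $S$ are $\delta$-fine: writing $d_S$ for the word metric (the path metric of the Cayley graph), for all $a,b,c\in G$, all shortest edge paths $[a,b]$ and $[a,c]$, and all vertices $v\in[a,b]$, $w\in[a,c]$ with $d_S(a,v)=d_S(a,w)\le \frac12\big(d_S(a,b)+d_S(a,c)-d_S(b,c)\big)$, one has $d_S(v,w)\le\delta$. Then there is a metric $\hat d$ on $G$ with the following properties. 1. $\hat d$ is $G$-invariant: $\hat d(gx,gy)=\hat d(x,y)$ for all $g,x,y\in G$. 2. $\hat d$ is quasi-isometric to the word metric: for every finite generating set $S$ of $G$ there are constants $A>0$ and $B\ge0$ such that $\frac1A\hat d(x,y)-B\le d_S(x,y)\le A\,\hat d(x,y)+B$ for all $x,y\in G$. 3. $(G,\hat d)$ is weakly geodesic: there is $\delta_1\ge0$ such that for all $x,y\in G$ and all $t\in[0,\hat d(x,y)]$ there is $a\in G$ with $\hat d(a,x)\le t+\delta_1$ and $\hat d(a,y)\le\hat d(x,y)-t+\delta_1$. 4.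 $(G,\hat d)$ is strongly bolic. That is, it is bolic: there is $\delta_2\ge0$ satisfying both (B1) for every $R>0$ there is $R'>0$ such that all $a,a',b,b'\in G$ with $\hat d(a,a')+\hat d(b,b')\le R$ and $\hat d(a,b)+\hat d(a',b')\ge R'$ satisfy $\hat d(a,b')+\hat d(a',b)\le\hat d(a,b)+\hat d(a',b')+2\delta_2$; (B2) there is a map $m:G\times G\to G$ such that $2\hat d(m(x,y),z)\le\big(2\hat d(x,z)^2+2\hat d(y,z)^2-\hat d(x,y)^2\big)^{1/2}+4\delta_2$ for all $x,y,z\in G$; and, moreover, (B1) holds for every $\delta_2>0$. -/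

import Mathlib

/-- `S` is a finite generating set of the group `G`. -/
def IsFiniteGeneratingSet {G : Type*} [Group G] (S : Set G) : Prop :=
  S.Finite ∧ Subgroup.closure S = ⊤

/-- The word metric of `G` with respect to `S`: the path metric of the Cayley graph of `G` with
respect to `S`, restricted to the vertices. (Loops and multiple edges, which `mulCayley` discards,
do not affect it.) -/
noncomputable def wordDist {G : Type*} [Group G] (S : Set G) (x y : G) : ℕ :=
  (SimpleGraph.mulCayley S).dist x y

/-- The Gromov product `(b | c)_a` with respect to the word metric. -/
noncomputable def gromovProduct {G : Type*} [Group G] (S : Set G) (a b c : G) : ℝ :=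
  ((wordDist S a b : ℝ) + (wordDist S a c : ℝ) - (wordDist S b c : ℝ)) / 2

/-- All geodesic triangles in the Cayley graph of `G` with respect to `S` are `δ`-fine.
The walks `p` and `q` are the two sides `[a, b]` and `[a, c]` issuing from the corner `a`; the
inscribed points on them lie at distance `(b | c)_a` from `a`, and two vertices on the two sides at
the same distance `n` from `a`, not beyond the inscribed points, are at distance at most `δ`.
(The other two corners are covered since `a`, `b`, `c` are arbitrary.) -/
def HasFineTriangles {G : Type*} [Group G] (S : Set G) (δ : ℝ) : Prop :=
  ∀ (a b c : G) (p : (SimpleGraph.mulCayley S).Walk a b) (q : (SimpleGraph.mulCayley S).Walk a c),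
    p.length = wordDist S a b → q.length = wordDist S a c →
    ∀ n : ℕ, (n : ℝ) ≤ gromovProduct S a b c →
      (wordDist S (p.getVert n) (q.getVert n) : ℝ) ≤ δ

/-- A hyperbolic group: it has a finite generating set such that, for some `δ ≥ 0`, all geodesic
triangles in the corresponding Cayley graph are `δ`-fine. -/
def IsHyperbolicGroup (G : Type*) [Group G] : Prop :=
  ∃ S : Set G, IsFiniteGeneratingSet S ∧ ∃ δ : ℝ, 0 ≤ δ ∧ HasFineTriangles S δ

/-- A weakly geodesic metric space. -/
def IsWeaklyGeodesic (X : Type*) [MetricSpace X] : Prop :=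
  ∃ δ : ℝ, 0 ≤ δ ∧ ∀ x y : X, ∀ t ∈ Set.Icc (0 : ℝ) (dist x y),
    ∃ a : X, dist a x ≤ t + δ ∧ dist a y ≤ dist x y - t + δ

/-- The first bolicity condition (B1) with constant `δ`. -/
def BolicB1 (X : Type*) [MetricSpace X] (δ : ℝ) : Prop :=
  ∀ R : ℝ, 0 < R → ∃ R' : ℝ, 0 < R' ∧ ∀ a a' b b' : X,
    dist a a' + dist b b' ≤ R → R' ≤ dist a b + dist a' b' →
      dist a b' + dist a' b ≤ dist a b + dist a' b' + 2 * δ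

/-- The second bolicity condition (B2) with constant `δ`. The number under the root is nonnegative
by the triangle inequality. -/
def BolicB2 (X : Type*) [MetricSpace X] (δ : ℝ) : Prop :=
  ∃ m : X → X → X, ∀ x y z : X,
    2 * dist (m x y) z ≤
      Real.sqrt (2 * dist x z ^ 2 + 2 * dist y z ^ 2 - dist x y ^ 2) + 4 * δ

/-- A bolic metric space. -/
def IsBolic (X : Type*) [MetricSpace X] : Prop :=
  ∃ δ : ℝ, 0 ≤ δ ∧ BolicB1 X δ ∧ BolicB2 X δ

/-- A strongly bolic metric space: it is bolic and (B1) holds for every positive constant. -/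
def IsStronglyBolic (X : Type*) [MetricSpace X] : Prop :=
  IsBolic X ∧ ∀ δ : ℝ, 0 < δ → BolicB1 X δ

/-- The metric of `G` is invariant under left translations. -/
def IsLeftInvariantMetric (G : Type*) [Group G] [MetricSpace G] : Prop :=
  ∀ g x y : G, dist (g * x) (g * y) = dist x y

/-- The metric of `G` is quasi-isometric to the word metric with respect to `S`
(through the identity map of `G`). -/
def IsQuasiIsometricToWordMetric (G : Type*) [Group G] [MetricSpace G] (S : Set G) : Prop :=
  ∃ A B : ℝ, 0 < A ∧ 0 ≤ B ∧ ∀ x y : G,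
    1 / A * dist x y - B ≤ (wordDist S x y : ℝ) ∧ (wordDist S x y : ℝ) ≤ A * dist x y + B

/-! Measure the distance from `a` to `b` by the total weight of the group elements that separate
them. A smooth kernel `W` detects whether the identity lies roughly between two points; summing its
translates over `G` gives `separation`, which is left invariant by construction. Only elements near
a word geodesic from `a` to `b` contribute, and for `a ≠ b` each vertex of the geodesic contributes
at least 1/4, so the sum is comparable with the word distance.

Strong bolicity comes from the form of `W`: a finite sum of products of a function of `a` and a
function of `b`, both Lipschitz for a visual metric at the identity. A second difference is then a
sum of products of two first differences. For bounded displacements of `a` and `b` it is `O(exp(-κ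
d(a,b)))` at every element, and only `O(d(a,b))` elements matter, so the total tends to 0
(`separation_mixed`).

First differences alone give errors decaying geometrically away from one point of a geodesic. Their
sum is bounded, so the triangle inequality and additivity along geodesics hold up to constants
(`exists_separation_triangle`, `exists_separation_add_le`). The first defect is repaired by adding a
constant off the diagonal. The second property yields weak geodesicity and, with fine triangles, the
midpoints for (B2) (`exists_midpoint`). -/

namespace WordMetric

variable {G : Type*} [Group G] {S : Set G}

/-! ### Word metrics and geodesics. -/

lemma reachable_mul (hS : Subgroup.closure S = ⊤) (u g : G) :
    (SimpleGraph.mulCayley S).Reachable u (u * g) := by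
  have hg : g ∈ Subgroup.closure S := by rw [hS]; trivial
  have step : ∀ v s : G, s ∈ S → (SimpleGraph.mulCayley S).Reachable v (v * s) := by
    intro v s hs
    by_cases h : v = v * s
    · rw [← h]
    · exact SimpleGraph.Adj.reachable
        ((SimpleGraph.mulCayley_adj S _ _).2 ⟨h, Or.inl (by simpa using hs)⟩)
  induction hg using Subgroup.closure_induction_right with
  | one => simp
  | mul_right x _ y hy ih =>
    rw [← mul_assoc]; exact ih.trans (step _ _ hy)
  | mul_inv_cancel x _ y hy ih =>
    refine ih.trans ?_
    have := step (u * (x * y⁻¹)) y hy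
    simpa [mul_assoc] using this.symm

lemma connected (hS : Subgroup.closure S = ⊤) : (SimpleGraph.mulCayley S).Connected where
  preconnected u v := by simpa using reachable_mul hS u (u⁻¹ * v)
  nonempty := ⟨1⟩

lemma wordDist_self (x : G) : wordDist S x x = 0 := SimpleGraph.dist_self

lemma wordDist_comm (x y : G) : wordDist S x y = wordDist S y x := SimpleGraph.dist_comm

lemma wordDist_triangle (hS : Subgroup.closure S = ⊤) (x y z : G) :
    wordDist S x z ≤ wordDist S x y + wordDist S y z := (connected hS).dist_triangle

lemma wordDist_pos (hS : Subgroup.closure S = ⊤) {x y : G} (h : x ≠ y) : 0 < wordDist S x y :=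
  (connected hS).pos_dist_of_ne h

lemma wordDist_mul_left_le (hS : Subgroup.closure S = ⊤) (g x y : G) :
    wordDist S (g * x) (g * y) ≤ wordDist S x y := by
  obtain ⟨p, hp⟩ := (connected hS).exists_walk_length_eq_dist x y
  let f : SimpleGraph.mulCayley S →g SimpleGraph.mulCayley S :=
    ⟨fun z => g * z, fun h => SimpleGraph.mulCayley_adj_mul_iff_right.2 h⟩
  have := SimpleGraph.dist_le (p.map f)
  rw [SimpleGraph.Walk.length_map, hp] at this
  exact this

lemma wordDist_mul_left (hS : Subgroup.closure S = ⊤) (g x y : G) :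
    wordDist S (g * x) (g * y) = wordDist S x y := by
  refine le_antisymm (wordDist_mul_left_le hS g x y) ?_
  simpa using wordDist_mul_left_le hS g⁻¹ (g * x) (g * y)

/-- `y` enumerates the vertices of a shortest edge path from `a` to `b`. -/
def IsGeodesic (S : Set G) (a b : G) (y : ℕ → G) : Prop :=
  ∃ p : (SimpleGraph.mulCayley S).Walk a b, p.length = wordDist S a b ∧ y = p.getVert

lemma exists_isGeodesic (hS : Subgroup.closure S = ⊤) (a b : G) : ∃ y, IsGeodesic S a b y := by
  obtain ⟨p, hp⟩ := (connected hS).exists_walk_length_eq_dist a b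
  exact ⟨_, p, hp, rfl⟩

namespace IsGeodesic

variable {a b : G} {y : ℕ → G}

lemma zero (h : IsGeodesic S a b y) : y 0 = a := by
  obtain ⟨p, -, rfl⟩ := h; simp

lemma last (h : IsGeodesic S a b y) : y (wordDist S a b) = b := by
  obtain ⟨p, hp, rfl⟩ := h; rw [← hp]; simp

lemma dist_succ_le (h : IsGeodesic S a b y) {i : ℕ} (hi : i < wordDist S a b) :
    wordDist S (y i) (y (i + 1)) ≤ 1 := by
  obtain ⟨p, hp, rfl⟩ := h
  exact (SimpleGraph.dist_eq_one_iff_adj.2 (p.adj_getVert_succ (hp ▸ hi))).le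

lemma dist_left (hS : Subgroup.closure S = ⊤) (h : IsGeodesic S a b y) {i : ℕ}
    (hi : i ≤ wordDist S a b) :
    wordDist S a (y i) = i ∧ wordDist S (y i) b + i = wordDist S a b := by
  obtain ⟨p, hp, rfl⟩ := h
  have h1 : wordDist S a (p.getVert i) ≤ i := by
    refine (SimpleGraph.dist_le (p.take i)).trans ?_
    rw [SimpleGraph.Walk.take_length]
    exact min_le_left _ _
  have h2 : wordDist S (p.getVert i) b ≤ wordDist S a b - i := by
    refine (SimpleGraph.dist_le (p.drop i)).trans ?_
    rw [SimpleGraph.Walk.drop_length, hp]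
  have h3 := wordDist_triangle hS a (p.getVert i) b
  omega

lemma dist_right (hS : Subgroup.closure S = ⊤) (h : IsGeodesic S a b y) {i : ℕ}
    (hi : i ≤ wordDist S a b) : (wordDist S (y i) b : ℝ) = wordDist S a b - i := by
  rw [← (h.dist_left hS hi).2]; push_cast; ring

end IsGeodesic

lemma wordDist_le_of_hasFineTriangles {δ : ℝ} (hf : HasFineTriangles S δ) {a b c : G} {y z : ℕ → G}
    (hy : IsGeodesic S a b y) (hz : IsGeodesic S a c z) {n : ℕ}
    (hn : (n : ℝ) ≤ gromovProduct S a b c) : (wordDist S (y n) (z n) : ℝ) ≤ δ := by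
  obtain ⟨p, hp, rfl⟩ := hy
  obtain ⟨q, hq, rfl⟩ := hz
  exact hf a b c p q hp hq n hn

/-! ### Gromov products in a hyperbolic group. -/

lemma wordDist_triangle_real (hS : Subgroup.closure S = ⊤) (x y z : G) :
    (wordDist S x z : ℝ) ≤ wordDist S x y + wordDist S y z := by
  exact_mod_cast wordDist_triangle hS x y z

lemma gromovProduct_comm (a b c : G) : gromovProduct S a b c = gromovProduct S a c b := by
  unfold gromovProduct; rw [wordDist_comm b c]; ring

lemma gromovProduct_nonneg (hS : Subgroup.closure S = ⊤) (a b c : G) :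
    0 ≤ gromovProduct S a b c := by
  have := wordDist_triangle_real hS b a c
  rw [wordDist_comm b a] at this
  unfold gromovProduct; linarith

lemma gromovProduct_le_left (hS : Subgroup.closure S = ⊤) (a b c : G) :
    gromovProduct S a b c ≤ wordDist S a b := by
  have := wordDist_triangle_real hS a b c
  unfold gromovProduct; linarith

lemma gromovProduct_le_right (hS : Subgroup.closure S = ⊤) (a b c : G) :
    gromovProduct S a b c ≤ wordDist S a c := by
  rw [gromovProduct_comm]; exact gromovProduct_le_left hS a c b

lemma gromovProduct_one (hS : Subgroup.closure S = ⊤) (x a b : G) :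
    gromovProduct S 1 (x⁻¹ * a) (x⁻¹ * b) = gromovProduct S x a b := by
  unfold gromovProduct
  rw [wordDist_mul_left hS, ← wordDist_mul_left hS x 1, ← wordDist_mul_left hS x 1]
  simp

lemma gromovProduct_base_le (hS : Subgroup.closure S = ⊤) (x y a b : G) :
    gromovProduct S y a b ≤ gromovProduct S x a b + wordDist S x y := by
  have h1 := wordDist_triangle_real hS y x a
  have h2 := wordDist_triangle_real hS y x b
  rw [wordDist_comm y x] at h1 h2
  unfold gromovProduct; linarith

/-- The four point inequality for Gromov products. -/
lemma min_gromovProduct_le (hS : Subgroup.closure S = ⊤) {δ : ℝ}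
    (hf : HasFineTriangles S δ) (o a b c : G) :
    min (gromovProduct S o a b) (gromovProduct S o b c) - (δ + 1) ≤ gromovProduct S o a c := by
  set t := min (gromovProduct S o a b) (gromovProduct S o b c) with ht
  have ht0 : 0 ≤ t := le_min (gromovProduct_nonneg hS _ _ _) (gromovProduct_nonneg hS _ _ _)
  obtain ⟨ya, hya⟩ := exists_isGeodesic hS o a
  obtain ⟨yb, hyb⟩ := exists_isGeodesic hS o b
  obtain ⟨yc, hyc⟩ := exists_isGeodesic hS o c
  -- Fineness speaks of vertices only; rounding `t` down costs the 1 in `δ + 1`.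
  set n := ⌊t⌋₊
  have hn : (n : ℝ) ≤ t := Nat.floor_le ht0
  have hn' : t < n + 1 := Nat.lt_floor_add_one t
  have h1 := wordDist_le_of_hasFineTriangles hf hya hyb (hn.trans (min_le_left _ _))
  have h2 := wordDist_le_of_hasFineTriangles hf hyb hyc (hn.trans (min_le_right _ _))
  have hna : n ≤ wordDist S o a := by
    exact_mod_cast (hn.trans (min_le_left _ _)).trans (gromovProduct_le_left hS _ _ _)
  have hnc : n ≤ wordDist S o c := by
    exact_mod_cast (hn.trans (min_le_right _ _)).trans (gromovProduct_le_right hS _ _ _)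
  have h3 := hya.dist_right hS hna
  have h4 := hyc.dist_right hS hnc
  have t1 := wordDist_triangle_real hS a (ya n) c
  have t2 := wordDist_triangle_real hS (ya n) (yc n) c
  have t3 := wordDist_triangle_real hS (ya n) (yb n) (yc n)
  rw [wordDist_comm a (ya n)] at t1
  unfold gromovProduct
  linarith

/-- Points with small Gromov product are close to geodesics. -/
lemma exists_wordDist_le_of_gromovProduct_le (hS : Subgroup.closure S = ⊤) {δ : ℝ}
    (hf : HasFineTriangles S δ) {a c x : G} {y : ℕ → G} (hy : IsGeodesic S a c y) {M : ℝ}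
    (hx : gromovProduct S x a c ≤ M) :
    ∃ i ≤ wordDist S a c, (wordDist S (y i) x : ℝ) ≤ M + 1 + δ := by
  obtain ⟨z, hz⟩ := exists_isGeodesic hS a x
  have h0 := gromovProduct_nonneg hS a x c
  set n := ⌊gromovProduct S a x c⌋₊
  have hn : (n : ℝ) ≤ gromovProduct S a x c := Nat.floor_le h0
  have hn' : gromovProduct S a x c < n + 1 := Nat.lt_floor_add_one _
  have hnx : n ≤ wordDist S a x := by exact_mod_cast hn.trans (gromovProduct_le_left hS _ _ _)
  have hnc : n ≤ wordDist S a c := by exact_mod_cast hn.trans (gromovProduct_le_right hS _ _ _)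
  refine ⟨n, hnc, ?_⟩
  have h1 := wordDist_le_of_hasFineTriangles hf hz hy hn
  have h2 := hz.dist_right hS hnx
  have h3 := wordDist_triangle_real hS (y n) (z n) x
  rw [wordDist_comm (y n) (z n)] at h3
  unfold gromovProduct at *
  rw [wordDist_comm x a] at hx
  linarith

/-! ### Finite balls, the visual metric and the separation kernel. -/

lemma finite_ball (hS : IsFiniteGeneratingSet S) (n : ℕ) : {x : G | wordDist S 1 x ≤ n}.Finite := by
  induction n with
  | zero =>
    refine (Set.finite_singleton (1 : G)).subset fun x hx => ?_
    by_contra h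
    have := wordDist_pos hS.2 (x := 1) (y := x) (fun h' => h h'.symm)
    simp only [Set.mem_ofPred_eq] at hx
    omega
  | succ n ih =>
    have hfin : (({1} ∪ S ∪ S⁻¹ : Set G)).Finite :=
      ((Set.finite_singleton _).union hS.1).union hS.1.inv
    refine (ih.mul hfin).subset fun x hx => ?_
    simp only [Set.mem_ofPred_eq] at hx
    rcases Nat.lt_or_ge (wordDist S 1 x) (n + 1) with h | h
    · exact ⟨x, Nat.lt_succ_iff.1 h, 1, by simp, by simp⟩
    · have hx' : wordDist S 1 x = n + 1 := le_antisymm hx h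
      obtain ⟨y, hy⟩ := exists_isGeodesic hS.2 1 x
      have hd := (hy.dist_left hS.2 (i := n) (by omega)).1
      have hl := hy.last
      obtain ⟨p, hp, rfl⟩ := hy
      have hadj := p.adj_getVert_succ (i := n) (by omega)
      rw [hx'] at hl
      rw [hl] at hadj
      refine ⟨p.getVert n, hd.le, (p.getVert n)⁻¹ * x, ?_, by simp⟩
      rcases ((SimpleGraph.mulCayley_adj S _ _).1 hadj).2 with h | h
      · exact Or.inl (Or.inr h)
      · exact Or.inr (by simpa using h)

/-- A visual pseudometric based at the identity. -/
lemma exists_visual_metric (hS : Subgroup.closure S = ⊤) {δ : ℝ} (hδ : 0 ≤ δ)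
    (hf : HasFineTriangles S δ) :
    ∃ κ : ℝ, 0 < κ ∧ ∃ v : G → G → ℝ, (∀ a, v a a = 0) ∧ (∀ a b, v a b = v b a) ∧
      (∀ a b c, v a c ≤ v a b + v b c) ∧
      (∀ a b, v a b ≤ Real.exp (-(κ * gromovProduct S 1 a b))) ∧
      (∀ a b, a ≠ b → Real.exp (-(κ * gromovProduct S 1 a b)) ≤ 2 * v a b) := by
  classical
  -- This makes the quasi-ultrametric constant `E` satisfy `E² = 2`, as Frink's metrization
  -- requires: two uses of `p_tri` give the factor 2 in `p_quad`.
  set κ : ℝ := Real.log 2 / (2 * (δ + 1)) with hκ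
  have hlog : 0 < Real.log 2 := Real.log_pos one_lt_two
  have hκ0 : 0 < κ := by positivity
  set E : ℝ := Real.exp (κ * (δ + 1)) with hE
  have hE1 : 1 ≤ E := Real.one_le_exp (by positivity)
  have hEE : E * E = 2 := by
    rw [hE, ← Real.exp_add, hκ]
    have : Real.log 2 / (2 * (δ + 1)) * (δ + 1) + Real.log 2 / (2 * (δ + 1)) * (δ + 1)
        = Real.log 2 := by
      have : δ + 1 ≠ 0 := by positivity
      field_simp; ring
    rw [this, Real.exp_log two_pos]
  -- The product `(a | a)_1` is finite, so the diagonal must be set to 0 by hand; hence the lower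
  -- bound on `v` only for `a ≠ b`.
  set p : G → G → ℝ := fun a b =>
    if a = b then 0 else Real.exp (-(κ * gromovProduct S 1 a b)) with hp
  have p_nonneg : ∀ a b, 0 ≤ p a b := fun a b => by
    simp only [hp]; split_ifs <;> positivity
  have p_self : ∀ a, p a a = 0 := fun a => by simp [hp]
  have p_comm : ∀ a b, p a b = p b a := fun a b => by
    simp only [hp, eq_comm (a := a), gromovProduct_comm 1 a b]
  have p_tri : ∀ a b c, p a c ≤ E * max (p a b) (p b c) := by
    intro a b c
    have hm : 0 ≤ max (p a b) (p b c) := le_max_of_le_left (p_nonneg _ _)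
    by_cases hab : a = b
    · subst hab; exact (le_max_right _ _).trans (le_mul_of_one_le_left hm hE1)
    by_cases hbc : b = c
    · subst hbc; exact (le_max_left _ _).trans (le_mul_of_one_le_left hm hE1)
    by_cases hac : a = c
    · subst hac; rw [p_self]; positivity
    have h4 := min_gromovProduct_le hS hf 1 a b c
    simp only [hp, if_neg hab, if_neg hbc, if_neg hac]
    rw [mul_max_of_nonneg _ _ (by positivity), hE, ← Real.exp_add, ← Real.exp_add]
    rcases min_choice (gromovProduct S 1 a b) (gromovProduct S 1 b c) with h | h
    · refine le_max_of_le_left (Real.exp_le_exp.2 ?_)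
      rw [h] at h4; nlinarith
    · refine le_max_of_le_right (Real.exp_le_exp.2 ?_)
      rw [h] at h4; nlinarith
  have p_quad : ∀ a b c d, p a d ≤ 2 * max (p a b) (max (p b c) (p c d)) := by
    intro a b c d
    have hE0 : 0 ≤ E := by positivity
    calc p a d ≤ E * max (p a b) (p b d) := p_tri a b d
      _ ≤ E * max (E * p a b) (E * max (p b c) (p c d)) := by
        gcongr
        · exact le_mul_of_one_le_left (p_nonneg _ _) hE1
        · exact p_tri b c d
      _ = _ := by rw [← mul_max_of_nonneg _ _ hE0, ← mul_assoc, hEE]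
  set P : G → G → NNReal := fun a b => (p a b).toNNReal with hP
  have hPp : ∀ a b, (P a b : ℝ) = p a b := fun a b => Real.coe_toNNReal _ (p_nonneg a b)
  have P_self : ∀ a, P a a = 0 := fun a => by simp [hP, p_self]
  have P_comm : ∀ a b, P a b = P b a := fun a b => by simp only [hP, p_comm a b]
  have P_quad : ∀ a b c d, P a d ≤ 2 * max (P a b) (max (P b c) (P c d)) := by
    intro a b c d
    rw [← NNReal.coe_le_coe]
    push_cast
    simp only [hPp]
    exact p_quad a b c d
  let _ := PseudoMetricSpace.ofPreNNDist P P_self P_comm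
  refine ⟨κ, hκ0, fun a b => dist a b, dist_self, dist_comm, dist_triangle, ?_, ?_⟩
  · intro a b
    refine (PseudoMetricSpace.dist_ofPreNNDist_le P P_self P_comm a b).trans ?_
    rw [hPp]
    simp only [hp]
    split_ifs <;> first | positivity | rfl
  · intro a b hab
    have := PseudoMetricSpace.le_two_mul_dist_ofPreNNDist P P_self P_comm P_quad a b
    rw [hPp] at this
    simpa only [hp, if_neg hab] using this

/-- A function measuring whether the identity separates two points. -/
structure IsSeparationKernel (S : Set G) (W : G → G → ℝ) (κ C M : ℝ) : Prop where
  symm : ∀ a b, W a b = W b a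
  nonneg : ∀ a b, 0 ≤ W a b
  le : ∀ a b, W a b ≤ C
  eq_zero : ∀ a b, M < gromovProduct S 1 a b → W a b = 0
  pos : ∀ a b, gromovProduct S 1 a b = 0 → a ≠ b → 1 / 4 ≤ W a b
  lip : ∀ a b b', |W a b - W a b'| ≤ C * Real.exp (-(κ * gromovProduct S 1 b b'))
  mixed : ∀ a a' b b', |W a b - W a' b - (W a b' - W a' b')| ≤
    C * (Real.exp (-(κ * gromovProduct S 1 a a')) * Real.exp (-(κ * gromovProduct S 1 b b')))

/-- Cover `G` by finitely many visual balls, take Lipschitz bumps `φ u` on them, and let `W a b` sum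
`φ u a * φ w b` over pairs of centres far apart. Visually close points then get weight 0, visually
distant ones positive weight. -/
lemma exists_isSeparationKernel (hS : IsFiniteGeneratingSet S) {δ : ℝ} (hδ : 0 ≤ δ)
    (hf : HasFineTriangles S δ) :
    ∃ (W : G → G → ℝ) (κ C M : ℝ), 0 < κ ∧ 0 ≤ C ∧ 0 ≤ M ∧ IsSeparationKernel S W κ C M := by
  classical
  obtain ⟨κ, hκ, v, v_self, v_comm, v_tri, v_le, le_v⟩ := exists_visual_metric hS.2 hδ hf
  obtain ⟨N, hN⟩ := exists_nat_ge (Real.log 16 / κ)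
  have hN' : Real.exp (-(κ * N)) ≤ 1 / 16 := by
    rw [div_le_iff₀ hκ] at hN
    have : Real.exp (-Real.log 16) = 1 / 16 := by
      rw [Real.exp_neg, Real.exp_log (by norm_num)]; norm_num
    rw [← this]
    exact Real.exp_le_exp.2 (by linarith)
  set F : Finset G := (finite_ball hS N).toFinset with hF
  -- A far point is visually close to the `N`-th vertex of a geodesic from 1 to it.
  have dense : ∀ a, ∃ u ∈ F, v u a ≤ 1 / 16 := by
    intro a
    rcases le_total (wordDist S 1 a) N with h | h
    · exact ⟨a, by simpa [hF] using h, by rw [v_self]; norm_num⟩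
    · obtain ⟨y, hy⟩ := exists_isGeodesic hS.2 1 a
      have h1 := (hy.dist_left hS.2 h).1
      have h2 := hy.dist_right hS.2 h
      refine ⟨y N, by simp [hF, h1], (v_le _ _).trans ?_⟩
      have : gromovProduct S 1 (y N) a = N := by
        unfold gromovProduct; rw [h1, h2]; ring
      rw [this]; exact hN'
  set φ : G → G → ℝ := fun u a => max 0 (1 - 8 * v u a) with hφ
  have φ_nonneg : ∀ u a, 0 ≤ φ u a := fun u a => le_max_left _ _
  have v_nonneg : ∀ a b, 0 ≤ v a b := fun a b => by
    have := v_tri a b a; rw [v_self, v_comm b a] at this; linarith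
  have φ_le : ∀ u a, φ u a ≤ 1 := fun u a => max_le zero_le_one (by linarith [v_nonneg u a])
  have φ_lip : ∀ u a b, |φ u a - φ u b| ≤ 8 * Real.exp (-(κ * gromovProduct S 1 a b)) := by
    intro u a b
    have h1 : |φ u a - φ u b| ≤ |(1 - 8 * v u a) - (1 - 8 * v u b)| := by
      simp only [hφ, max_comm (0 : ℝ)]
      exact abs_max_sub_max_le_abs _ _ _
    refine h1.trans ?_
    have h2 := v_tri u a b
    have h3 := v_tri u b a
    have h4 := v_le a b
    rw [v_comm b a] at h3
    rw [abs_le]; constructor <;> linarith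
  have φ_zero : ∀ u a, 1 / 8 ≤ v u a → φ u a = 0 := fun u a h => max_eq_left (by linarith)
  -- The threshold serves both ends. Bumps have radius 1/8, so a nonzero term forces `v a b > 1/8`.
  -- If `(a | b)_1 = 0` and `a ≠ b`, then `v a b ≥ 1/2`, and centres within 1/16 are still 3/8
  -- apart.
  set T : G → G → ℝ := fun u w => if 3 / 8 ≤ v u w then 1 else 0 with hT
  have T_nonneg : ∀ u w, 0 ≤ T u w := fun u w => by simp only [hT]; split_ifs <;> norm_num
  have T_le : ∀ u w, T u w ≤ 1 := fun u w => by simp only [hT]; split_ifs <;> norm_num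
  set W : G → G → ℝ := fun a b => ∑ u ∈ F, ∑ w ∈ F, T u w * (φ u a * φ w b) with hW
  have bound : ∀ (g : G → G → ℝ) (B : ℝ), (∀ u w, |g u w| ≤ B) →
      |∑ u ∈ F, ∑ w ∈ F, T u w * g u w| ≤ (F.card : ℝ) ^ 2 * B := by
    intro g B hg
    calc |∑ u ∈ F, ∑ w ∈ F, T u w * g u w|
        ≤ ∑ u ∈ F, ∑ w ∈ F, |T u w * g u w| :=
          (Finset.abs_sum_le_sum_abs _ _).trans
            (Finset.sum_le_sum fun u _ => Finset.abs_sum_le_sum_abs _ _)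
      _ ≤ ∑ u ∈ F, ∑ w ∈ F, B := by
          refine Finset.sum_le_sum fun u _ => Finset.sum_le_sum fun w _ => ?_
          rw [abs_mul, abs_of_nonneg (T_nonneg u w)]
          exact (mul_le_of_le_one_left (abs_nonneg _) (T_le u w)).trans (hg u w)
      _ = _ := by simp; ring
  set k : ℝ := (F.card : ℝ) ^ 2 with hk
  have hk0 : 0 ≤ k := by positivity
  have hexp : ∀ a b, 0 < Real.exp (-(κ * gromovProduct S 1 a b)) := fun _ _ => Real.exp_pos _
  refine ⟨W, κ, k * 64, Real.log 8 / κ, hκ, by positivity,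
    div_nonneg (Real.log_nonneg (by norm_num)) hκ.le, ?_, ?_, ?_, ?_, ?_, ?_, ?_⟩
  · intro a b
    simp only [hW]
    rw [Finset.sum_comm]
    refine Finset.sum_congr rfl fun u _ => Finset.sum_congr rfl fun w _ => ?_
    simp only [hT, v_comm w u]; ring
  · exact fun a b => Finset.sum_nonneg fun u _ => Finset.sum_nonneg fun w _ =>
      mul_nonneg (T_nonneg _ _) (mul_nonneg (φ_nonneg _ _) (φ_nonneg _ _))
  · intro a b
    refine (le_abs_self _).trans ((bound (fun u w => φ u a * φ w b) 1 fun u w => ?_).trans ?_)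
    · rw [abs_of_nonneg (mul_nonneg (φ_nonneg _ _) (φ_nonneg _ _))]
      exact mul_le_one₀ (φ_le _ _) (φ_nonneg _ _) (φ_le _ _)
    · linarith
  · intro a b hab
    refine Finset.sum_eq_zero fun u _ => Finset.sum_eq_zero fun w _ => ?_
    by_contra h
    have hu : v u a < 1 / 8 := by
      by_contra h'; exact h (by rw [φ_zero u a (not_lt.1 h')]; ring)
    have hw : v w b < 1 / 8 := by
      by_contra h'; exact h (by rw [φ_zero w b (not_lt.1 h')]; ring)
    have huw : 3 / 8 ≤ v u w := by
      by_contra h'; exact h (by simp only [hT, if_neg h']; ring)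
    have h1 := v_tri u a w
    have h2 := v_tri a b w
    rw [v_comm b w] at h2
    have h3 : 1 / 8 < Real.exp (-(κ * gromovProduct S 1 a b)) := by linarith [v_le a b]
    have h4 := Real.log_lt_log (by norm_num) h3
    rw [Real.log_exp, one_div, Real.log_inv] at h4
    rw [div_lt_iff₀ hκ] at hab
    linarith
  · intro a b hab hne
    obtain ⟨u, hu, hua⟩ := dense a
    obtain ⟨w, hw, hwb⟩ := dense b
    have h1 := le_v a b hne
    rw [hab] at h1
    simp only [mul_zero, neg_zero, Real.exp_zero] at h1
    have h2 := v_tri a u b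
    have h3 := v_tri u w b
    rw [v_comm a u] at h2
    have hTuw : T u w = 1 := if_pos (by linarith)
    have hφu : 1 / 2 ≤ φ u a := le_max_of_le_right (by linarith)
    have hφw : 1 / 2 ≤ φ w b := le_max_of_le_right (by linarith)
    have hterm : ∀ u w, 0 ≤ T u w * (φ u a * φ w b) := fun u w =>
      mul_nonneg (T_nonneg _ _) (mul_nonneg (φ_nonneg _ _) (φ_nonneg _ _))
    calc (1 / 4 : ℝ) ≤ T u w * (φ u a * φ w b) := by rw [hTuw]; nlinarith
      _ ≤ ∑ w ∈ F, T u w * (φ u a * φ w b) :=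
          Finset.single_le_sum (f := fun w => T u w * (φ u a * φ w b)) (fun w _ => hterm u w) hw
      _ ≤ W a b :=
          Finset.single_le_sum (f := fun u => ∑ w ∈ F, T u w * (φ u a * φ w b))
            (fun u _ => Finset.sum_nonneg fun w _ => hterm u w) hu
  · intro a b b'
    have : W a b - W a b' = ∑ u ∈ F, ∑ w ∈ F, T u w * (φ u a * (φ w b - φ w b')) := by
      simp only [hW, ← Finset.sum_sub_distrib]
      refine Finset.sum_congr rfl fun u _ => Finset.sum_congr rfl fun w _ => ?_
      ring
    rw [this]
    refine (bound _ (8 * Real.exp (-(κ * gromovProduct S 1 b b'))) fun u w => ?_).trans ?_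
    · rw [abs_mul, abs_of_nonneg (φ_nonneg u a)]
      exact (mul_le_of_le_one_left (abs_nonneg _) (φ_le u a)).trans (φ_lip w b b')
    · nlinarith [mul_nonneg hk0 (hexp b b').le]
  · intro a a' b b'
    -- The second difference factors because each summand is a product.
    have : W a b - W a' b - (W a b' - W a' b') =
        ∑ u ∈ F, ∑ w ∈ F, T u w * ((φ u a - φ u a') * (φ w b - φ w b')) := by
      simp only [hW, ← Finset.sum_sub_distrib]
      refine Finset.sum_congr rfl fun u _ => Finset.sum_congr rfl fun w _ => ?_
      ring
    rw [this]
    refine (bound _ (8 * Real.exp (-(κ * gromovProduct S 1 a a')) *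
      (8 * Real.exp (-(κ * gromovProduct S 1 b b')))) fun u w => ?_).trans (le_of_eq (by ring))
    rw [abs_mul]
    exact mul_le_mul (φ_lip u a a') (φ_lip w b b') (abs_nonneg _) (by positivity)

/-! ### Sums over neighbourhoods of geodesics. -/

lemma finite_closedBall (hS : IsFiniteGeneratingSet S) (c : G) (n : ℕ) :
    {x : G | wordDist S c x ≤ n}.Finite := by
  refine ((finite_ball hS n).image (fun z => c * z)).subset fun x hx => ⟨c⁻¹ * x, ?_, by simp⟩
  rw [Set.mem_ofPred_eq, ← wordDist_mul_left hS.2 c]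
  simpa using hx

/-- Such points lie in finitely many balls centred on a geodesic. This ensures that the `finsum`s
below have finite support and do not take their default value 0. -/
lemma finite_gromovProduct_le (hS : IsFiniteGeneratingSet S) {δ : ℝ}
    (hf : HasFineTriangles S δ) (a c : G) (M : ℝ) : {x : G | gromovProduct S x a c ≤ M}.Finite := by
  obtain ⟨y, hy⟩ := exists_isGeodesic hS.2 a c
  refine ((Finset.range (wordDist S a c + 1)).finite_toSet.biUnion fun i _ =>
    finite_closedBall hS (y i) ⌊M + 1 + δ⌋₊).subset fun x hx => ?_
  obtain ⟨i, hi, hix⟩ := exists_wordDist_le_of_gromovProduct_le hS.2 hf hy hx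
  simp only [Set.mem_iUnion]
  exact ⟨i, by simpa using Nat.lt_succ_of_le hi, Nat.le_floor hix⟩

/-- Sums of functions supported near a geodesic are bounded by sums along the geodesic. -/
lemma exists_finsum_le (hS : IsFiniteGeneratingSet S) {δ : ℝ}
    (hf : HasFineTriangles S δ) (M : ℝ) :
    ∃ K : ℝ, 0 ≤ K ∧ ∀ (a c : G) (y : ℕ → G), IsGeodesic S a c y → ∀ (h : G → ℝ) (g : ℕ → ℝ),
      (∀ i, 0 ≤ g i) → (∀ x, h x ≠ 0 → gromovProduct S x a c ≤ M) →
      (∀ x, ∀ i ≤ wordDist S a c, (wordDist S (y i) x : ℝ) ≤ M + 1 + δ → h x ≤ g i) →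
      ∑ᶠ x, h x ≤ K * ∑ i ∈ Finset.range (wordDist S a c + 1), g i := by
  classical
  set B : Finset G := (finite_ball hS ⌊M + 1 + δ⌋₊).toFinset with hB
  refine ⟨B.card, by positivity, fun a c y hy h g hg hsupp hle => ?_⟩
  set T : Finset G := (finite_gromovProduct_le hS hf a c M).toFinset with hT
  have hex : ∀ x, ∃ i, x ∈ T →
      i ≤ wordDist S a c ∧ (wordDist S (y i) x : ℝ) ≤ M + 1 + δ := by
    intro x
    by_cases hx : x ∈ T
    · obtain ⟨i, hi⟩ := exists_wordDist_le_of_gromovProduct_le hS.2 hf hy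
        (by simpa [hT] using hx : gromovProduct S x a c ≤ M)
      exact ⟨i, fun _ => hi⟩
    · exact ⟨0, fun h => absurd h hx⟩
  choose ι hι using hex
  rw [finsum_eq_sum_of_support_subset (s := T) h fun x hx => by
    simpa [hT] using hsupp x hx]
  -- Assign to each point a nearby vertex of the geodesic; each fibre lies in a translate of the
  -- ball `B`.
  rw [← Finset.sum_fiberwise_of_maps_to (t := Finset.range (wordDist S a c + 1)) (g := ι)
    (fun x hx => by simpa using Nat.lt_succ_of_le (hι x hx).1), Finset.mul_sum]
  refine Finset.sum_le_sum fun i _ => ?_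
  have hcard : (T.filter fun x => ι x = i).card ≤ B.card := by
    refine (Finset.card_le_card (t := B.image fun z => y i * z) fun x hx => ?_).trans
      Finset.card_image_le
    obtain ⟨hxT, rfl⟩ := Finset.mem_filter.1 hx
    refine Finset.mem_image.2 ⟨(y (ι x))⁻¹ * x, ?_, by simp⟩
    rw [hB, Set.Finite.mem_toFinset, Set.mem_ofPred_eq, ← wordDist_mul_left hS.2 (y (ι x))]
    simpa using Nat.le_floor (hι x hxT).2
  calc ∑ x ∈ T with ι x = i, h x ≤ (T.filter fun x => ι x = i).card • g i :=
        Finset.sum_le_card_nsmul _ _ _ fun x hx => by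
          obtain ⟨hxT, rfl⟩ := Finset.mem_filter.1 hx
          exact hle x _ (hι x hxT).1 (hι x hxT).2
    _ ≤ B.card * g i := by
        rw [nsmul_eq_mul]
        exact mul_le_mul_of_nonneg_right (by exact_mod_cast hcard) (hg i)

/-- Compare with the two-sided geometric series centred at `⌊t⌋`, at the price of a factor `exp κ`;
the bound is uniform in `n` and `t`. -/
lemma exists_sum_exp_neg_abs_le {κ : ℝ} (hκ : 0 < κ) :
    ∃ K : ℝ, 0 ≤ K ∧ ∀ (n : ℕ) (t : ℝ),
      ∑ i ∈ Finset.range n, Real.exp (-(κ * |(i : ℝ) - t|)) ≤ K := by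
  set f : ℤ → ℝ := fun j => Real.exp (-(κ * |(j : ℝ)|)) with hf
  have hgeo : Summable fun n : ℕ => Real.exp (-(κ * n)) := by
    have : (fun n : ℕ => Real.exp (-(κ * n))) = fun n : ℕ => Real.exp (-κ) ^ n := by
      ext n; rw [← Real.exp_nat_mul]; ring_nf
    rw [this]
    exact summable_geometric_of_lt_one (Real.exp_pos _).le (by simpa using hκ)
  have hs : Summable f := by
    refine Summable.of_nat_of_neg ?_ ?_ <;> simpa [hf] using hgeo
  refine ⟨Real.exp κ * ∑' j, f j, mul_nonneg (Real.exp_pos _).le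
    (tsum_nonneg fun j => (Real.exp_pos _).le), fun n t => ?_⟩
  have hinj : Function.Injective fun i : ℕ => (i : ℤ) - ⌊t⌋ := fun i j hij => by
    simpa using hij
  calc ∑ i ∈ Finset.range n, Real.exp (-(κ * |(i : ℝ) - t|))
      ≤ ∑ i ∈ Finset.range n, Real.exp κ * f ((i : ℤ) - ⌊t⌋) := by
        refine Finset.sum_le_sum fun i _ => ?_
        rw [hf, ← Real.exp_add]
        refine Real.exp_le_exp.2 ?_
        have h1 := Int.floor_le t
        have h2 := Int.lt_floor_add_one t
        have h3 : |((i : ℝ) - ⌊t⌋)| ≤ |(i : ℝ) - t| + 1 := by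
          have := abs_add_le ((i : ℝ) - t) (t - ⌊t⌋)
          rw [abs_of_nonneg (sub_nonneg.2 h1)] at this
          have h4 : (i : ℝ) - t + (t - ⌊t⌋) = i - ⌊t⌋ := by ring
          rw [h4] at this
          linarith
        push_cast
        nlinarith
    _ = Real.exp κ * ∑ j ∈ (Finset.range n).map ⟨_, hinj⟩, f j := by
        rw [← Finset.mul_sum, Finset.sum_map]; rfl
    _ ≤ _ := by
        gcongr
        exact hs.sum_le_tsum _ fun j _ => (Real.exp_pos _).le

/-- The gap function `|i - (b|c)_a|` controls Gromov products along a geodesic `[a, c]`. -/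
lemma IsGeodesic.sub_le_gromovProduct (hS : Subgroup.closure S = ⊤) {a c : G} {y : ℕ → G}
    (hy : IsGeodesic S a c y) (b : G) {i : ℕ} (hi : i ≤ wordDist S a c) :
    (i : ℝ) - gromovProduct S a b c ≤ gromovProduct S (y i) a b ∧
      gromovProduct S a b c - i ≤ gromovProduct S (y i) b c := by
  have h1 := (hy.dist_left hS hi).1
  have h2 := hy.dist_right hS hi
  have h3 := wordDist_triangle_real hS b (y i) c
  have h4 := wordDist_triangle_real hS a (y i) b
  unfold gromovProduct
  rw [wordDist_comm (y i) a, h1]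
  rw [wordDist_comm b (y i)] at h3
  rw [h1] at h4
  constructor <;> linarith

/-- Along `[a, c]` the first bound decays beyond the inscribed point at `(b | c)_a`, the second
before it. Together they give a geometric series in both directions, whose sum does not depend on
the triangle. -/
lemma exists_finsum_le_of_exp (hS : IsFiniteGeneratingSet S) {δ : ℝ}
    (hf : HasFineTriangles S δ) (M : ℝ) {κ : ℝ} (hκ : 0 < κ) :
    ∃ K : ℝ, 0 ≤ K ∧ ∀ (a b c : G) (C : ℝ) (h : G → ℝ), 0 ≤ C →
      (∀ x, h x ≠ 0 → gromovProduct S x a c ≤ M) →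
      (∀ x, h x ≤ C * Real.exp (-(κ * gromovProduct S x a b))) →
      (∀ x, h x ≤ C * Real.exp (-(κ * gromovProduct S x b c))) →
      ∑ᶠ x, h x ≤ C * K := by
  obtain ⟨K, hK, hsum⟩ := exists_finsum_le hS hf M
  obtain ⟨L, hL, hexp⟩ := exists_sum_exp_neg_abs_le hκ
  set E := Real.exp (κ * (M + 1 + δ)) with hE
  refine ⟨K * (E * L), by positivity, fun a b c C h hC hsupp h1 h2 => ?_⟩
  obtain ⟨y, hy⟩ := exists_isGeodesic hS.2 a c
  set t := gromovProduct S a b c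
  have key := hsum a c y hy h (fun i => C * E * Real.exp (-(κ * |(i : ℝ) - t|)))
    (fun i => by positivity) hsupp (fun x i hi hix => ?_)
  · rw [← Finset.mul_sum] at key
    calc _ ≤ _ := key
      _ ≤ K * (C * E * L) := by gcongr; exact hexp _ _
      _ = _ := by ring
  · obtain ⟨g1, g2⟩ := hy.sub_le_gromovProduct hS.2 b hi
    have g3 := gromovProduct_base_le hS.2 x (y i) a b
    have g4 := gromovProduct_base_le hS.2 x (y i) b c
    rw [wordDist_comm x] at g3 g4
    rw [mul_assoc, hE, ← Real.exp_add]
    rcases le_total 0 ((i : ℝ) - t) with hit | hit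
    · refine (h1 x).trans (mul_le_mul_of_nonneg_left (Real.exp_le_exp.2 ?_) hC)
      rw [abs_of_nonneg hit]; nlinarith
    · refine (h2 x).trans (mul_le_mul_of_nonneg_left (Real.exp_le_exp.2 ?_) hC)
      rw [abs_of_nonpos hit]; nlinarith

/-! ### The separation function: growth, near-additivity and second differences. -/

/-- The total weight of the group elements separating `a` from `b`. -/
noncomputable def separation (W : G → G → ℝ) (a b : G) : ℝ := ∑ᶠ x : G, W (x⁻¹ * a) (x⁻¹ * b)

lemma separation_mul_left (W : G → G → ℝ) (g a b : G) :
    separation W (g * a) (g * b) = separation W a b := by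
  unfold separation
  rw [← finsum_comp_equiv (Equiv.mulLeft g)]
  simp [mul_assoc]

namespace IsSeparationKernel

variable {W : G → G → ℝ} {κ C M δ : ℝ}

lemma separation_comm (hW : IsSeparationKernel S W κ C M) (a b : G) :
    separation W a b = separation W b a := by
  unfold separation; simp only [hW.symm (_ * a)]

lemma separation_nonneg (hW : IsSeparationKernel S W κ C M) (a b : G) :
    0 ≤ separation W a b := finsum_nonneg fun _ => hW.nonneg _ _

lemma gromovProduct_le (hW : IsSeparationKernel S W κ C M) (hS : Subgroup.closure S = ⊤)
    {x a b : G} (h : W (x⁻¹ * a) (x⁻¹ * b) ≠ 0) : gromovProduct S x a b ≤ M := by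
  rw [← gromovProduct_one hS]
  by_contra h'
  exact h (hW.eq_zero _ _ (not_le.1 h'))

lemma finite_support (hW : IsSeparationKernel S W κ C M) (hS : IsFiniteGeneratingSet S)
    (hf : HasFineTriangles S δ) (a b : G) :
    (Function.support fun x : G => W (x⁻¹ * a) (x⁻¹ * b)).Finite :=
  (finite_gromovProduct_le hS hf a b M).subset fun _ hx => hW.gromovProduct_le hS.2 hx

lemma exists_separation_le (hW : IsSeparationKernel S W κ C M) (hS : IsFiniteGeneratingSet S)
    (hf : HasFineTriangles S δ) (hC : 0 ≤ C) :
    ∃ K : ℝ, 0 ≤ K ∧ ∀ a b, separation W a b ≤ K * (wordDist S a b + 1) := by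
  obtain ⟨K, hK, hsum⟩ := exists_finsum_le hS hf M
  refine ⟨K * C, by positivity, fun a b => ?_⟩
  obtain ⟨y, hy⟩ := exists_isGeodesic hS.2 a b
  have := hsum a b y hy (fun x => W (x⁻¹ * a) (x⁻¹ * b)) (fun _ => C) (fun _ => hC)
    (fun x hx => hW.gromovProduct_le hS.2 hx) (fun x i _ _ => hW.le _ _)
  refine this.trans (le_of_eq ?_)
  simp; ring

/-- From a vertex of a geodesic between `a` and `b` their Gromov product is 0, so `pos` applies
there. -/
lemma le_separation (hW : IsSeparationKernel S W κ C M) (hS : IsFiniteGeneratingSet S)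
    (hf : HasFineTriangles S δ) {a b : G} (hab : a ≠ b) :
    (wordDist S a b : ℝ) / 4 ≤ separation W a b := by
  classical
  obtain ⟨y, hy⟩ := exists_isGeodesic hS.2 a b
  have hinj : Set.InjOn y (Finset.range (wordDist S a b)) := by
    intro i hi j hj hij
    have h1 := (hy.dist_left hS.2 (Finset.mem_range.1 hi).le).1
    have h2 := (hy.dist_left hS.2 (Finset.mem_range.1 hj).le).1
    rw [← h1, ← h2, hij]
  set F := (hW.finite_support hS hf a b).toFinset ∪ (Finset.range (wordDist S a b)).image y with hF
  unfold separation
  rw [finsum_eq_sum_of_support_subset (s := F) _ fun x hx => by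
    simp only [hF, Finset.coe_union, Set.Finite.coe_toFinset]; exact Or.inl hx]
  calc (wordDist S a b : ℝ) / 4 = ∑ x ∈ (Finset.range (wordDist S a b)).image y, (1 / 4 : ℝ) := by
        rw [Finset.sum_const, Finset.card_image_of_injOn hinj]; simp; ring
    _ ≤ ∑ x ∈ (Finset.range (wordDist S a b)).image y, W (x⁻¹ * a) (x⁻¹ * b) := by
        refine Finset.sum_le_sum fun x hx => ?_
        obtain ⟨i, hi, rfl⟩ := Finset.mem_image.1 hx
        have hi' := (Finset.mem_range.1 hi).le
        refine hW.pos _ _ ?_ (by simpa using hab)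
        rw [gromovProduct_one hS.2]
        unfold gromovProduct
        rw [hy.dist_right hS.2 hi', wordDist_comm, (hy.dist_left hS.2 hi').1]
        ring
    _ ≤ _ := Finset.sum_le_sum_of_subset_of_nonneg Finset.subset_union_right
        fun x _ _ => hW.nonneg _ _

lemma lip_left (hW : IsSeparationKernel S W κ C M) (hS : Subgroup.closure S = ⊤) (x a b c : G) :
    |W (x⁻¹ * a) (x⁻¹ * b) - W (x⁻¹ * a) (x⁻¹ * c)| ≤
      C * Real.exp (-(κ * gromovProduct S x b c)) := by
  rw [← gromovProduct_one hS]; exact hW.lip _ _ _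

lemma lip_right (hW : IsSeparationKernel S W κ C M) (hS : Subgroup.closure S = ⊤) (x a b c : G) :
    |W (x⁻¹ * b) (x⁻¹ * a) - W (x⁻¹ * c) (x⁻¹ * a)| ≤
      C * Real.exp (-(κ * gromovProduct S x b c)) := by
  rw [hW.symm _ (x⁻¹ * a), hW.symm _ (x⁻¹ * a)]; exact hW.lip_left hS _ _ _ _

/-- Dropping either subtracted weight from the pointwise defect leaves a first difference of `W`, so
`lip` supplies both bounds of `exists_finsum_le_of_exp`. -/
lemma exists_separation_triangle (hW : IsSeparationKernel S W κ C M)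
    (hS : IsFiniteGeneratingSet S) (hf : HasFineTriangles S δ) (hκ : 0 < κ) (hC : 0 ≤ C) :
    ∃ K : ℝ, 0 ≤ K ∧ ∀ a b c, separation W a c ≤ separation W a b + separation W b c + K := by
  classical
  obtain ⟨K, hK, hsum⟩ := exists_finsum_le_of_exp hS hf M hκ
  refine ⟨C * K, by positivity, fun a b c => ?_⟩
  set e : G → ℝ := fun x => W (x⁻¹ * a) (x⁻¹ * c) -
    (W (x⁻¹ * a) (x⁻¹ * b) + W (x⁻¹ * b) (x⁻¹ * c)) with he
  have hfin := hW.finite_support hS hf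
  have hsub : separation W a c - (separation W a b + separation W b c) = ∑ᶠ x, e x := by
    unfold separation
    rw [← finsum_add_distrib (hfin a b) (hfin b c), ← finsum_sub_distrib (hfin a c)]
    exact ((hfin a b).union (hfin b c)).subset (Function.support_add _ _)
  -- Away from `[a, c]` the defect is nonpositive but need not vanish, so it is cut off.
  set h : G → ℝ := fun x => if gromovProduct S x a c ≤ M then e x else 0 with hh
  have heh : ∀ x, e x ≤ h x := by
    intro x
    simp only [hh]
    split_ifs with hx
    · exact le_rfl
    · have : W (x⁻¹ * a) (x⁻¹ * c) = 0 := by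
        by_contra h'; exact hx (hW.gromovProduct_le hS.2 h')
      simp only [he, this]
      linarith [hW.nonneg (x⁻¹ * a) (x⁻¹ * b), hW.nonneg (x⁻¹ * b) (x⁻¹ * c)]
  have hsupp : ∀ x, h x ≠ 0 → gromovProduct S x a c ≤ M := by
    intro x hx
    by_contra h'
    exact hx (if_neg h')
  have hle : ∑ᶠ x, e x ≤ ∑ᶠ x, h x := by
    refine finsum_le_finsum' ?_ ((finite_gromovProduct_le hS hf a c M).subset hsupp) heh
    exact ((hfin a c).union ((hfin a b).union (hfin b c))).subset
      ((Function.support_sub _ _).trans (Set.union_subset_union_right _ (Function.support_add _ _)))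
  have hpos : ∀ x b c, 0 ≤ C * Real.exp (-(κ * gromovProduct S x b c)) :=
    fun _ _ _ => mul_nonneg hC (Real.exp_pos _).le
  have key := hsum a b c C h hC hsupp
    (fun x => by
      simp only [hh]
      split_ifs
      · have := (abs_le.1 (hW.lip_right hS.2 x c a b)).2
        simp only [he]
        linarith [hW.nonneg (x⁻¹ * a) (x⁻¹ * b)]
      · exact hpos _ _ _)
    (fun x => by
      simp only [hh]
      split_ifs
      · have := (abs_le.1 (hW.lip_left hS.2 x a b c)).1
        simp only [he]
        linarith [hW.nonneg (x⁻¹ * b) (x⁻¹ * c)]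
      · exact hpos _ _ _)
  linarith

lemma le_exp (hW : IsSeparationKernel S W κ C M) (hS : Subgroup.closure S = ⊤) (hκ : 0 < κ)
    (hC : 0 ≤ C) (x a b : G) : W (x⁻¹ * a) (x⁻¹ * b) ≤
      C * Real.exp (κ * M) * Real.exp (-(κ * gromovProduct S x a b)) := by
  by_cases h : W (x⁻¹ * a) (x⁻¹ * b) = 0
  · rw [h]; positivity
  · have h1 := hW.gromovProduct_le hS h
    refine (hW.le _ _).trans ?_
    rw [mul_assoc, ← Real.exp_add]
    refine le_mul_of_one_le_right hC (Real.one_le_exp ?_)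
    nlinarith

/-- For `b` between `a` and `c`, `(a | c)_x` is at most `(a | b)_x` and `(b | c)_x`, so the defect
vanishes away from `[a, c]`. It is bounded by one weight (`le_exp`) plus one first difference. -/
lemma exists_separation_add_le (hW : IsSeparationKernel S W κ C M)
    (hS : IsFiniteGeneratingSet S) (hf : HasFineTriangles S δ) (hκ : 0 < κ) (hC : 0 ≤ C) :
    ∃ K : ℝ, 0 ≤ K ∧ ∀ a b c, (wordDist S a b : ℝ) + wordDist S b c = wordDist S a c →
      separation W a b + separation W b c ≤ separation W a c + K := by
  obtain ⟨K, hK, hsum⟩ := exists_finsum_le_of_exp hS hf M hκ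
  set C' := C + C * Real.exp (κ * M) with hC'
  have hC'0 : 0 ≤ C' := by positivity
  refine ⟨C' * K, by positivity, fun a b c habc => ?_⟩
  have hfin := hW.finite_support hS hf
  set e : G → ℝ := fun x => (W (x⁻¹ * a) (x⁻¹ * b) + W (x⁻¹ * b) (x⁻¹ * c)) -
    W (x⁻¹ * a) (x⁻¹ * c) with he
  have hsub : (separation W a b + separation W b c) - separation W a c = ∑ᶠ x, e x := by
    unfold separation
    rw [← finsum_add_distrib (hfin a b) (hfin b c), ← finsum_sub_distrib _ (hfin a c)]
    exact ((hfin a b).union (hfin b c)).subset (Function.support_add _ _)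
  have hsupp : ∀ x, e x ≠ 0 → gromovProduct S x a c ≤ M := by
    intro x hx
    by_contra hM
    refine hx ?_
    have h1 := wordDist_triangle_real hS.2 x b c
    have h2 := wordDist_triangle_real hS.2 x b a
    rw [wordDist_comm b a] at h2
    have z1 : W (x⁻¹ * a) (x⁻¹ * b) = 0 := by
      by_contra h'
      have := hW.gromovProduct_le hS.2 h'
      unfold gromovProduct at *
      linarith
    have z2 : W (x⁻¹ * b) (x⁻¹ * c) = 0 := by
      by_contra h'
      have := hW.gromovProduct_le hS.2 h'
      unfold gromovProduct at *
      linarith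
    have z3 : W (x⁻¹ * a) (x⁻¹ * c) = 0 := by
      by_contra h'; exact hM (hW.gromovProduct_le hS.2 h')
    simp only [he, z1, z2, z3]; ring
  have key := hsum a b c C' e hC'0 hsupp
    (fun x => by
      have h1 := (abs_le.1 (hW.lip_right hS.2 x c a b)).1
      have h2 := hW.le_exp hS.2 hκ hC x a b
      simp only [he, hC', add_mul]
      linarith)
    (fun x => by
      have h1 := (abs_le.1 (hW.lip_left hS.2 x a b c)).2
      have h2 := hW.le_exp hS.2 hκ hC x b c
      simp only [he, hC', add_mul]
      linarith)
  linarith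

/-- Since `(a | a')_x ≥ d(x,a) - ρ`, and likewise for `b`, the two exponents in `mixed` add up to at
least `κ (d(a,b) - 2ρ)`, whatever `x` is. The factor `d(a,b) + 1` counts the vertices of `[a, b]`.
-/
lemma separation_mixed (hW : IsSeparationKernel S W κ C M)
    (hS : IsFiniteGeneratingSet S) (hf : HasFineTriangles S δ) (hκ : 0 < κ) (hC : 0 ≤ C) (ρ : ℝ) :
    ∃ K : ℝ, 0 ≤ K ∧ ∀ a a' b b', (wordDist S a a' : ℝ) ≤ ρ → (wordDist S b b' : ℝ) ≤ ρ →
      separation W a b' + separation W a' b ≤ separation W a b + separation W a' b' +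
        K * ((wordDist S a b + 1) * Real.exp (-(κ * wordDist S a b))) := by
  obtain ⟨K, hK, hsum⟩ := exists_finsum_le hS hf (M + 2 * ρ)
  refine ⟨K * (C * Real.exp (κ * (2 * ρ))), by positivity, fun a a' b b' ha hb => ?_⟩
  have hfin := hW.finite_support hS hf
  obtain ⟨y, hy⟩ := exists_isGeodesic hS.2 a b
  set e : G → ℝ := fun x => (W (x⁻¹ * a) (x⁻¹ * b') + W (x⁻¹ * a') (x⁻¹ * b)) -
    (W (x⁻¹ * a) (x⁻¹ * b) + W (x⁻¹ * a') (x⁻¹ * b')) with he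
  have hsub : (separation W a b' + separation W a' b) - (separation W a b + separation W a' b') =
      ∑ᶠ x, e x := by
    unfold separation
    rw [← finsum_add_distrib (hfin a b') (hfin a' b), ← finsum_add_distrib (hfin a b) (hfin a' b'),
      ← finsum_sub_distrib]
    · exact ((hfin a b').union (hfin a' b)).subset (Function.support_add _ _)
    · exact ((hfin a b).union (hfin a' b')).subset (Function.support_add _ _)
  have hsupp : ∀ x, e x ≠ 0 → gromovProduct S x a b ≤ M + 2 * ρ := by
    intro x hx
    by_contra hM
    refine hx ?_
    have z : ∀ u v, (wordDist S a u : ℝ) ≤ ρ → (wordDist S b v : ℝ) ≤ ρ →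
        W (x⁻¹ * u) (x⁻¹ * v) = 0 := by
      intro u v hu hv
      by_contra h'
      have h0 := hW.gromovProduct_le hS.2 h'
      have h1 := wordDist_triangle_real hS.2 x u a
      have h2 := wordDist_triangle_real hS.2 x v b
      have h3 := wordDist_triangle_real hS.2 u a v
      have h4 := wordDist_triangle_real hS.2 a b v
      rw [wordDist_comm u a] at h1 h3
      rw [wordDist_comm v b] at h2
      unfold gromovProduct at *
      linarith
    have haa : (wordDist S a a : ℝ) ≤ ρ := by
      rw [wordDist_self, Nat.cast_zero]; exact (Nat.cast_nonneg _).trans ha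
    have hbb : (wordDist S b b : ℝ) ≤ ρ := by
      rw [wordDist_self, Nat.cast_zero]; exact (Nat.cast_nonneg _).trans ha
    simp only [he, z a b haa hbb, z a b' haa hb, z a' b ha hbb, z a' b' ha hb]
    ring
  have key := hsum a b y hy e
    (fun _ => C * Real.exp (κ * (2 * ρ)) * Real.exp (-(κ * wordDist S a b)))
    (fun _ => by positivity) hsupp (fun x i _ _ => by
      have h1 := (abs_le.1 (hW.mixed (x⁻¹ * a) (x⁻¹ * a') (x⁻¹ * b) (x⁻¹ * b'))).1
      rw [gromovProduct_one hS.2, gromovProduct_one hS.2, ← Real.exp_add] at h1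
      have h2 : -(κ * gromovProduct S x a a') + -(κ * gromovProduct S x b b') ≤
          κ * (2 * ρ) + -(κ * wordDist S a b) := by
        have h3 := wordDist_triangle_real hS.2 a x b
        have h4 := wordDist_triangle_real hS.2 x a' a
        have h5 := wordDist_triangle_real hS.2 x b' b
        rw [wordDist_comm a x] at h3
        rw [wordDist_comm a' a] at h4
        rw [wordDist_comm b' b] at h5
        have h6 : (wordDist S a b : ℝ) ≤
            2 * ρ + gromovProduct S x a a' + gromovProduct S x b b' := by
          unfold gromovProduct; linarith
        nlinarith
      have h7 := mul_le_mul_of_nonneg_left (Real.exp_le_exp.2 h2) hC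
      rw [Real.exp_add, ← mul_assoc, Real.exp_add] at h7
      rw [Real.exp_add] at h1
      simp only [he]
      linarith)
  have hcalc : K * ∑ i ∈ Finset.range (wordDist S a b + 1),
      C * Real.exp (κ * (2 * ρ)) * Real.exp (-(κ * wordDist S a b)) =
      K * (C * Real.exp (κ * (2 * ρ))) *
        ((wordDist S a b + 1) * Real.exp (-(κ * wordDist S a b))) := by
    simp; ring
  linarith

end IsSeparationKernel

/-! ### The distance function. -/

/-- A left-invariant distance function on `G` that is additive along geodesics of the word metric up
to the constant `L`, and whose second differences are small for far away pairs of points. -/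
structure IsStrongDist (S : Set G) (D : G → G → ℝ) (L : ℝ) : Prop where
  self : ∀ a, D a a = 0
  comm : ∀ a b, D a b = D b a
  triangle : ∀ a b c, D a c ≤ D a b + D b c
  mul_left : ∀ g a b, D (g * a) (g * b) = D a b
  wordDist_le : ∀ a b, (wordDist S a b : ℝ) ≤ 4 * D a b
  le_wordDist : ∀ a b, D a b ≤ L * wordDist S a b
  add_le : ∀ a b c, (wordDist S a b : ℝ) + wordDist S b c = wordDist S a c →
    D a b + D b c ≤ D a c + L
  mixed : ∀ ρ ε : ℝ, 0 < ε → ∃ N : ℝ, ∀ a a' b b', (wordDist S a a' : ℝ) ≤ ρ →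
    (wordDist S b b' : ℝ) ≤ ρ → N ≤ wordDist S a b → D a b' + D a' b ≤ D a b + D a' b' + ε

lemma exists_mul_exp_lt {κ : ℝ} (hκ : 0 < κ) (K : ℝ) {ε : ℝ} (hε : 0 < ε) :
    ∃ N : ℕ, ∀ n : ℕ, N ≤ n → K * (((n : ℝ) + 1) * Real.exp (-(κ * n))) < ε := by
  have hr : Real.exp (-κ) < 1 := by simpa using hκ
  have h1 := tendsto_self_mul_const_pow_of_lt_one (Real.exp_pos (-κ)).le hr
  have h2 := tendsto_pow_atTop_nhds_zero_of_lt_one (Real.exp_pos (-κ)).le hr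
  have h3 := (h1.add h2).const_mul K
  rw [add_zero, mul_zero] at h3
  obtain ⟨N, hN⟩ := Filter.eventually_atTop.1 (h3.eventually (gt_mem_nhds hε))
  refine ⟨N, fun n hn => ?_⟩
  have h4 : Real.exp (-(κ * n)) = Real.exp (-κ) ^ n := by
    rw [← Real.exp_nat_mul]; ring_nf
  rw [h4, add_mul, one_mul]
  exact hN n hn

lemma exists_isStrongDist (hS : IsFiniteGeneratingSet S) {δ : ℝ} (hδ : 0 ≤ δ)
    (hf : HasFineTriangles S δ) : ∃ (D : G → G → ℝ) (L : ℝ), 0 ≤ L ∧ IsStrongDist S D L := by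
  classical
  obtain ⟨W, κ, C, M, hκ, hC, -, hW⟩ := exists_isSeparationKernel hS hδ hf
  obtain ⟨K₁, hK₁, upper⟩ := hW.exists_separation_le hS hf hC
  obtain ⟨K₂, hK₂, tri⟩ := hW.exists_separation_triangle hS hf hκ hC
  obtain ⟨K₃, hK₃, add⟩ := hW.exists_separation_add_le hS hf hκ hC
  have lower := fun (a b : G) (hab : a ≠ b) => hW.le_separation hS hf hab
  have nonneg := hW.separation_nonneg
  -- The added constant absorbs the defect in the triangle inequality and cancels in second
  -- differences.
  set D : G → G → ℝ := fun a b => if a = b then 0 else separation W a b + K₂ with hD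
  have D_self : ∀ a, D a a = 0 := fun a => if_pos rfl
  have D_ne : ∀ {a b}, a ≠ b → D a b = separation W a b + K₂ := fun h => if_neg h
  have D_nonneg : ∀ a b, 0 ≤ D a b := fun a b => by
    simp only [hD]; split_ifs
    · exact le_rfl
    · linarith [nonneg a b]
  refine ⟨D, 2 * K₁ + K₂ + K₃, by positivity, D_self, ?_, ?_, ?_, ?_, ?_, ?_, ?_⟩
  · intro a b
    simp only [hD, eq_comm (a := a), hW.separation_comm a b]
  · intro a b c
    by_cases hab : a = b
    · subst hab; rw [D_self]; linarith
    by_cases hbc : b = c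
    · subst hbc; rw [D_self]; linarith
    by_cases hac : a = c
    · subst hac; rw [D_self]; exact add_nonneg (D_nonneg _ _) (D_nonneg _ _)
    rw [D_ne hab, D_ne hbc, D_ne hac]
    linarith [tri a b c]
  · intro g a b
    simp only [hD, mul_right_inj, separation_mul_left]
  · intro a b
    by_cases hab : a = b
    · subst hab; rw [D_self, wordDist_self]; simp
    · rw [D_ne hab]; linarith [lower a b hab]
  · intro a b
    by_cases hab : a = b
    · subst hab; rw [D_self, wordDist_self]; simp
    · rw [D_ne hab]
      have h1 : (1 : ℝ) ≤ wordDist S a b := by exact_mod_cast wordDist_pos hS.2 hab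
      nlinarith [upper a b]
  · intro a b c habc
    by_cases hab : a = b
    · subst hab; rw [D_self]; linarith
    by_cases hbc : b = c
    · subst hbc; rw [D_self]; linarith
    by_cases hac : a = c
    · subst hac
      have h1 : (0 : ℝ) < wordDist S a b := by exact_mod_cast wordDist_pos hS.2 hab
      have h2 : (0 : ℝ) ≤ wordDist S b a := Nat.cast_nonneg _
      rw [wordDist_self, Nat.cast_zero] at habc
      linarith
    rw [D_ne hab, D_ne hbc, D_ne hac]
    linarith [add a b c habc]
  · intro ρ ε hε
    obtain ⟨K, -, hmix⟩ := hW.separation_mixed hS hf hκ hC ρ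
    obtain ⟨N, hN⟩ := exists_mul_exp_lt hκ K hε
    -- The bound `2 * ρ + 1` keeps all four pairs off the diagonal, where `D` jumps.
    refine ⟨max N (2 * ρ + 1), fun a a' b b' ha hb hab => ?_⟩
    have ne : ∀ u v, (wordDist S a u : ℝ) ≤ ρ → (wordDist S b v : ℝ) ≤ ρ → u ≠ v := by
      rintro u _ hu hv rfl
      have h1 := wordDist_triangle_real hS.2 a u b
      rw [wordDist_comm u b] at h1
      linarith [(le_max_right (N : ℝ) (2 * ρ + 1)).trans hab]
    have hρ : 0 ≤ ρ := (Nat.cast_nonneg _).trans ha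
    have haa : (wordDist S a a : ℝ) ≤ ρ := by rwa [wordDist_self, Nat.cast_zero]
    have hbb : (wordDist S b b : ℝ) ≤ ρ := by rwa [wordDist_self, Nat.cast_zero]
    rw [D_ne (ne a b haa hbb), D_ne (ne a b' haa hb), D_ne (ne a' b ha hbb), D_ne (ne a' b' ha hb)]
    have h2 : N ≤ wordDist S a b := by exact_mod_cast (le_max_left _ _).trans hab
    linarith [hmix a a' b b' ha hb, hN _ h2]

lemma IsGeodesic.reverse {a b : G} {y : ℕ → G} (h : IsGeodesic S a b y) :
    IsGeodesic S b a fun i => y (wordDist S a b - i) := by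
  obtain ⟨p, hp, rfl⟩ := h
  refine ⟨p.reverse, by rw [SimpleGraph.Walk.length_reverse, hp, wordDist_comm], ?_⟩
  ext i
  rw [SimpleGraph.Walk.getVert_reverse, hp]

/-! ### Intermediate points and midpoints. -/

namespace IsStrongDist

variable {D : G → G → ℝ} {L δ : ℝ}

lemma nonneg (hD : IsStrongDist S D L) (a b : G) : 0 ≤ D a b := by
  have := hD.wordDist_le a b
  have h : (0 : ℝ) ≤ wordDist S a b := Nat.cast_nonneg _
  linarith

lemma exists_intermediate (hD : IsStrongDist S D L) (hL : 0 ≤ L) {a b : G} {y : ℕ → G}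
    (hy : IsGeodesic S a b y) {t : ℝ} (ht0 : 0 ≤ t) (ht : t ≤ D a b) :
    ∃ j ≤ wordDist S a b, D a (y j) ≤ t ∧ t ≤ D a (y j) + L := by
  classical
  -- Take the last vertex with `D a (y j) ≤ t`; one edge changes `D` by at most `L`.
  set n := wordDist S a b with hn
  set j := Nat.findGreatest (fun i => D a (y i) ≤ t) n with hj
  have hjn : j ≤ n := Nat.findGreatest_le n
  have hjt : D a (y j) ≤ t :=
    Nat.findGreatest_spec (P := fun i => D a (y i) ≤ t) (Nat.zero_le n)
      (by rw [hy.zero, hD.self]; exact ht0)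
  refine ⟨j, hjn, hjt, ?_⟩
  rcases hjn.eq_or_lt with h | h
  · rw [h, hn, hy.last]; linarith
  · have h1 : ¬ D a (y (j + 1)) ≤ t :=
      Nat.findGreatest_is_greatest (P := fun i => D a (y i) ≤ t) (Nat.lt_succ_self j) h
    have h2 := hD.triangle a (y j) (y (j + 1))
    have h3 := hD.le_wordDist (y j) (y (j + 1))
    have h4 : (wordDist S (y j) (y (j + 1)) : ℝ) ≤ 1 := by exact_mod_cast hy.dist_succ_le h
    nlinarith

/-- Geodesics with a common origin fellow-travel, so a vertex on one side of a triangle is almost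
between the endpoints of another side. -/
lemma le_of_fellow (hD : IsStrongDist S D L) (hS : Subgroup.closure S = ⊤) (hL : 0 ≤ L)
    (hf : HasFineTriangles S δ) {a b z : G} {y : ℕ → G} (hy : IsGeodesic S a b y) {j : ℕ}
    (hj : (j : ℝ) ≤ gromovProduct S a b z) :
    D a (y j) + D (y j) z ≤ D a z + (L + 2 * (L * δ)) := by
  obtain ⟨w, hw⟩ := exists_isGeodesic hS a z
  have hjz : j ≤ wordDist S a z := by exact_mod_cast hj.trans (gromovProduct_le_right hS _ _ _)
  have h1 := wordDist_le_of_hasFineTriangles hf hy hw hj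
  have h2 : D (y j) (w j) ≤ L * δ := (hD.le_wordDist _ _).trans (by gcongr)
  have h3 := hD.triangle (y j) (w j) z
  have h4 := hD.triangle a (w j) (y j)
  rw [hD.comm (w j) (y j)] at h4
  have h5 := hD.add_le a (w j) z (by
    rw [hw.dist_right hS hjz, (hw.dist_left hS hjz).1]; ring)
  linarith

/-- The vertex halfway along `[x, y]` lies on one side of the inscribed point of the triangle `x, y,
z`. It is therefore almost between `z` and `x`, or almost between `z` and `y`. -/
lemma exists_midpoint (hD : IsStrongDist S D L) (hS : Subgroup.closure S = ⊤) (hL : 0 ≤ L)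
    (hf : HasFineTriangles S δ) (x y : G) : ∃ m, ∀ z,
      D m z ≤ max (D x z) (D y z) - D x y / 2 + (2 * L + 2 * (L * δ)) := by
  obtain ⟨p, hp⟩ := exists_isGeodesic hS x y
  have h0 := hD.nonneg x y
  obtain ⟨j, hj, h1, h2⟩ := hD.exists_intermediate hL hp (t := D x y / 2) (by linarith)
    (by linarith)
  refine ⟨p j, fun z => ?_⟩
  by_cases hjz : (j : ℝ) ≤ gromovProduct S x y z
  · have h3 := hD.le_of_fellow hS hL hf hp hjz
    linarith [le_max_left (D x z) (D y z)]
  · have h4 : ((wordDist S x y - j : ℕ) : ℝ) ≤ gromovProduct S y x z := by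
      rw [Nat.cast_sub hj]
      unfold gromovProduct at *
      rw [wordDist_comm y x]
      linarith
    have h3 := hD.le_of_fellow hS hL hf hp.reverse h4
    simp only [Nat.sub_sub_self hj] at h3
    have h5 := hD.triangle x (p j) y
    rw [hD.comm (p j) y] at h5
    linarith [le_max_right (D x z) (D y z)]

/-- The metric space structure given by the distance function. -/
noncomputable abbrev metricSpace (hD : IsStrongDist S D L) (hS : Subgroup.closure S = ⊤) :
    MetricSpace G where
  dist := D
  dist_self := hD.self
  dist_comm := hD.comm
  dist_triangle := hD.triangle
  eq_of_dist_eq_zero {x y} h := by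
    by_contra hne
    have h1 := hD.wordDist_le x y
    have h2 : (0 : ℝ) < wordDist S x y := by exact_mod_cast wordDist_pos hS hne
    have h3 : D x y = 0 := h
    linarith

end IsStrongDist

/-! ### Change of generators, and the inequality behind (B2). -/

lemma exists_wordDist_le_mul (hS : IsFiniteGeneratingSet S) {S' : Set G}
    (hS' : Subgroup.closure S' = ⊤) :
    ∃ A : ℝ, 0 ≤ A ∧ ∀ x y : G, (wordDist S' x y : ℝ) ≤ A * wordDist S x y := by
  obtain ⟨A, hA⟩ := (hS.1.image fun s => wordDist S' 1 s).bddAbove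
  have step : ∀ u v, (SimpleGraph.mulCayley S).Adj u v → wordDist S' u v ≤ A := by
    have aux : ∀ u v : G, u⁻¹ * v ∈ S → wordDist S' u v ≤ A := fun u v h => by
      have : wordDist S' 1 (u⁻¹ * v) ≤ A := hA ⟨_, h, rfl⟩
      rw [← wordDist_mul_left hS' u] at this
      simpa using this
    intro u v huv
    rcases ((SimpleGraph.mulCayley_adj S _ _).1 huv).2 with h | h
    · exact aux u v h
    · rw [wordDist_comm]; exact aux v u h
  have walk : ∀ (x y : G) (p : (SimpleGraph.mulCayley S).Walk x y),
      wordDist S' x y ≤ A * p.length := by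
    intro x y p
    induction p with
    | nil => simp [wordDist_self]
    | cons h p ih =>
      refine (wordDist_triangle hS' _ _ _).trans ((add_le_add (step _ _ h) ih).trans ?_)
      rw [SimpleGraph.Walk.length_cons]
      linarith
  refine ⟨A, by positivity, fun x y => ?_⟩
  obtain ⟨p, hp⟩ := (connected hS.2).exists_walk_length_eq_dist x y
  have := walk x y p
  rw [hp] at this
  exact_mod_cast this

/-- If `p` is the maximum, the difference of the squares is `2 (p + q - l) (l + q - p)`. -/
lemma two_mul_sub_le_sqrt {p q l : ℝ} (h1 : l ≤ p + q) (h2 : p ≤ l + q) (h3 : q ≤ l + p) :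
    2 * max p q - l ≤ Real.sqrt (2 * p ^ 2 + 2 * q ^ 2 - l ^ 2) := by
  apply Real.le_sqrt_of_sq_le
  rcases max_choice p q with h | h <;> rw [h]
  · nlinarith [mul_nonneg (sub_nonneg.2 h1) (sub_nonneg.2 h2)]
  · nlinarith [mul_nonneg (sub_nonneg.2 h1) (sub_nonneg.2 h3)]

end WordMetric

open WordMetric

theorem theorem17 {G : Type*} [Group G] (hG : IsHyperbolicGroup G) :
    ∃ _ : MetricSpace G,
      IsLeftInvariantMetric G ∧
      (∀ S : Set G, IsFiniteGeneratingSet S → IsQuasiIsometricToWordMetric G S) ∧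
      IsWeaklyGeodesic G ∧
      IsStronglyBolic G := by
  obtain ⟨S, hS, δ, hδ, hf⟩ := hG
  obtain ⟨D, L, hL, hD⟩ := exists_isStrongDist hS hδ hf
  have bolic : ∀ ε : ℝ, 0 < ε → @BolicB1 G (hD.metricSpace hS.2) ε := by
    intro ε hε R hR
    obtain ⟨N, hN⟩ := hD.mixed (4 * R) (2 * ε) (by linarith)
    -- If `a` and `b` were closer than `N`, then `D a b ≤ L * max N 0` and `D a' b'` would exceed
    -- this by at most `R`.
    refine ⟨max 1 (2 * (L * max N 0) + R + 1), by positivity, fun a a' b b' h1 h2 => ?_⟩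
    change D a a' + D b b' ≤ R at h1
    change _ ≤ D a b + D a' b' at h2
    change D a b' + D a' b ≤ D a b + D a' b' + 2 * ε
    have n1 := hD.nonneg a a'
    have n2 := hD.nonneg b b'
    refine hN a a' b b' ((hD.wordDist_le _ _).trans (by linarith))
      ((hD.wordDist_le _ _).trans (by linarith)) ?_
    by_contra h3
    have h4 : D a b ≤ L * max N 0 := (hD.le_wordDist a b).trans
      (mul_le_mul_of_nonneg_left ((not_le.1 h3).le.trans (le_max_left _ _)) hL)
    have h5 := hD.triangle a' a b'
    have h6 := hD.triangle a b b'
    rw [hD.comm a' a] at h5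
    linarith [(le_max_right 1 (2 * (L * max N 0) + R + 1)).trans h2]
  refine ⟨hD.metricSpace hS.2, fun g x y => hD.mul_left g x y, fun S' hS' => ?_, ?_, ?_, bolic⟩
  · obtain ⟨A₁, hA₁, h₁⟩ := exists_wordDist_le_mul hS' hS.2
    obtain ⟨A₂, hA₂, h₂⟩ := exists_wordDist_le_mul hS hS'.2
    refine ⟨L * A₁ + 4 * A₂ + 1, 0, by positivity, le_rfl, fun x y => ?_⟩
    change 1 / _ * D x y - 0 ≤ _ ∧ _ ≤ _ * D x y + 0
    have hd : (0 : ℝ) ≤ wordDist S' x y := Nat.cast_nonneg _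
    have hn := hD.nonneg x y
    constructor
    · rw [sub_zero, one_div_mul_eq_div, div_le_iff₀ (by positivity)]
      have h3 := (hD.le_wordDist x y).trans (mul_le_mul_of_nonneg_left (h₁ x y) hL)
      nlinarith [mul_nonneg hA₂ hd]
    · have h3 := (h₂ x y).trans (mul_le_mul_of_nonneg_left (hD.wordDist_le x y) hA₂)
      nlinarith [mul_nonneg (mul_nonneg hL hA₁) hn]
  · refine ⟨2 * L, by positivity, fun x y t ht => ?_⟩
    obtain ⟨p, hp⟩ := exists_isGeodesic hS.2 x y
    obtain ⟨j, hj, h1, h2⟩ := hD.exists_intermediate hL hp ht.1 ht.2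
    have h3 := hD.add_le x (p j) y (by
      rw [hp.dist_right hS.2 hj, (hp.dist_left hS.2 hj).1]; ring)
    refine ⟨p j, ?_, ?_⟩
    · change D (p j) x ≤ t + 2 * L
      rw [hD.comm]; linarith
    · change D (p j) y ≤ D x y - t + 2 * L
      linarith
  · choose m hm using hD.exists_midpoint hS.2 hL hf
    -- Four times `L + L * δ` is twice the midpoint error; the 1 makes the constant positive, as
    -- `bolic` requires.
    refine ⟨L + L * δ + 1, by positivity, bolic _ (by positivity), m, fun x y z => ?_⟩
    change 2 * D (m x y) z ≤ Real.sqrt (2 * D x z ^ 2 + 2 * D y z ^ 2 - D x y ^ 2) + _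
    have h1 := hD.triangle x z y
    have h2 := hD.triangle x y z
    have h3 := hD.triangle y x z
    rw [hD.comm z y] at h1
    rw [hD.comm y x] at h3
    linarith [two_mul_sub_le_sqrt h1 h2 h3, hm x y z]
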